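/- Let $X$ be a real, reflexive, separable Banach space with dual $X^*$, let $(\Omega,\mathcal F,\mathbb P)$ be a complete probability space, and let $f:X\times\Omega\to\mathbb R\cup\{\infty\}$, $f_\omega:=f(\cdot,\omega)$, be a normal convex integrand: $f$ is not identically $\infty$, $f$ is measurable with respect to the product of the Borel $\sigma$-algebra of $X$ and $\mathcal F$, and each $f_\omega$ is convex and lower semicontinuous. Call $\varphi:\Omega\to[-\infty,\infty]$ majorized by the integrable function $g$ if $|\varphi(\omega)|\le g(\omega)$ a.s. For $x\in L^\infty(\Omega,X)$ set $I_f(x)=\int_\Omega f_\omega(x(\omega))\,d\mathbb P(\omega)$ if $\omega\mapsto f_\omega(x(\omega))$ is majorized by an integrable function, and $I_f(x)=\infty$ otherwise; let $\operatorname{dom}(I_f)=\{x\in L^\infty(\Omega,X): I_f(x)<\infty\}$. Let $f_\omega^*(x^*)=\sup_{x\in X}\{\langle x^*,x\rangle-f_\omega(x)\}$ for $x^*\in X^*$, and let $\sigma(K,v)=\sup_{x\in K}v(x)$ for $K\subset L^\infty(\Omega,X)$ and $v\in (L^\infty(\Omega,X))^*$. A functional $v^\circ\in(L^\infty(\Omega,X))^*$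 is singular if there are $F_n\in\mathcal F$ with $F_{n+1}\subset F_n$ and $\mathbb P(F_n)\to0$ such that $v^\circ(x)=0$ for every $x\in L^\infty(\Omega,X)$ which, for some $n$, vanishes a.e. on $F_n$. **Theorem.** Let $\bar x\in L^\infty(\Omega,X)$ with $I_f(\bar x)<\infty$, and suppose that there are $r>0$ and an integrable function $k_r:\Omega\to\mathbb R$ such that, for every $x\in L^\infty(\Omega,X)$ with $\|x-\bar x\|_{L^\infty(\Omega,X)}<r$, one has $f_\omega(x(\omega))\le k_r(\omega)$ for almost every $\omega$. Then: 1. there is at least one $x^*\in L^1(\Omega,X^*)$ for which $\omega\mapsto f_\omega^*(x^*(\omega))$ is majorized by an integrable function; 2. $I_f$ is finite and continuous at every $x\in L^\infty(\Omega,X)$ with $\|x-\bar x\|_{L^\infty(\Omega,X)}<r$; 3. for every singular functional $v^\circ\in(L^\infty(\Omega,X))^*$, $$\sigma(\operatorname{dom}(I_f),v^\circ)\ \ge\ v^\circ(\bar x)+r\,\|v^\circ\|_{(L^\infty(\Omega,X))^*}.$$ -/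

import Mathlib

open MeasureTheory Filter Topology

section Integrands

variable {X Ω : Type*}

/-- A real normed space is reflexive if its canonical map into the bidual is onto. -/
def ReflexiveSpace (X : Type*) [NormedAddCommGroup X] [NormedSpace ℝ X] : Prop :=
  Function.Surjective (NormedSpace.inclusionInDoubleDual ℝ X)

/-- `f : X × Ω → ℝ ∪ {∞}` (curried, with `f · ω = f_ω`) is a normal convex integrand. -/
structure IsNormalConvexIntegrand [NormedAddCommGroup X] [NormedSpace ℝ X]
    [MeasurableSpace X] [MeasurableSpace Ω] (f : X → Ω → EReal) : Prop where
  /-- the value `-∞` is not taken -/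
  ne_bot : ∀ x ω, f x ω ≠ ⊥
  /-- `f` is not identically `∞` -/
  not_identically_top : ∃ x ω, f x ω ≠ ⊤
  /-- joint measurability with respect to the product σ-algebra -/
  measurable : Measurable fun p : X × Ω => f p.1 p.2
  /-- `f_ω` is lower semicontinuous -/
  lowerSemicontinuous : ∀ ω, LowerSemicontinuous fun x => f x ω
  /-- `f_ω` is convex -/
  convex : ∀ ω (x y : X) (a b : ℝ), 0 < a → 0 < b → a + b = 1 →
    f (a • x + b • y) ω ≤ (a : EReal) * f x ω + (b : EReal) * f y ω

/-- `|φ| ≤ g` almost surely for some integrable real function `g`. -/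
def IsIntegrablyMajorized [MeasurableSpace Ω] (φ : Ω → EReal) (μ : Measure Ω) : Prop :=
  ∃ g : Ω → ℝ, Integrable g μ ∧ ∀ᵐ ω ∂μ, -(g ω : EReal) ≤ φ ω ∧ φ ω ≤ (g ω : EReal)

open Classical in
/-- `I_f(x) = ∫ f_ω(x(ω)) dμ(ω)` if `ω ↦ |f_ω(x(ω))|` has an integrable majorant, and
`I_f(x) = ∞` otherwise. -/
noncomputable def integralFunctional [MeasurableSpace Ω] (f : X → Ω → EReal) (μ : Measure Ω)
    (x : Ω → X) : EReal :=
  if IsIntegrablyMajorized (fun ω => f (x ω) ω) μ then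
    ((∫ ω, (f (x ω) ω).toReal ∂μ : ℝ) : EReal)
  else ⊤

/-- The functional `I_f` on `L^∞(Ω, X)`. -/
noncomputable def integralFunctionalLinfty [NormedAddCommGroup X] [MeasurableSpace Ω]
    (f : X → Ω → EReal) (μ : Measure Ω) (x : Lp X (⊤ : ENNReal) μ) : EReal :=
  integralFunctional f μ (x : Ω → X)

/-- The effective domain of an extended-real-valued function. -/
def effectiveDomain {E : Type*} (h : E → EReal) : Set E := {x | h x < ⊤}

/-- The conjugate `f_ω^*(x^*) = sup_x (⟨x^*, x⟩ - f_ω(x))`. -/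
noncomputable def conjugateIntegrand [NormedAddCommGroup X] [NormedSpace ℝ X]
    (f : X → Ω → EReal) (q : StrongDual ℝ X) (ω : Ω) : EReal :=
  ⨆ x : X, ((q x : ℝ) : EReal) - f x ω

/-- The support function `σ(K, v) = sup_{x ∈ K} v(x)`. -/
noncomputable def supportFunction {E : Type*} [NormedAddCommGroup E] [NormedSpace ℝ E]
    (K : Set E) (v : StrongDual ℝ E) : EReal :=
  ⨆ x ∈ K, ((v x : ℝ) : EReal)

/-- Singular functionals on `L^∞(Ω, X)`. -/
def IsSingularFunctional [NormedAddCommGroup X] [NormedSpace ℝ X] [MeasurableSpace Ω]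
    {μ : Measure Ω} (v : StrongDual ℝ (Lp X (⊤ : ENNReal) μ)) : Prop :=
  ∃ F : ℕ → Set Ω, (∀ n, MeasurableSet (F n)) ∧ (∀ n, F (n + 1) ⊆ F n) ∧
    Tendsto (fun n => μ (F n)) atTop (𝓝 0) ∧
    ∀ x : Lp X (⊤ : ENNReal) μ, (∃ n, ∀ᵐ ω ∂μ, ω ∈ F n → x ω = 0) → v x = 0

end Integrands

/-! Testing the hypothesis with constant perturbations of `xbar` along a dense sequence, and using
lower semicontinuity, gives almost surely `f_ω ≤ k ω` on the whole ball of radius `r` about `xbar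
ω`. A convex function bounded above near a point has a subgradient there, of norm controlled by the
bound; at a subgradient the conjugate has an explicit finite value, so claim 1 reduces to a
measurable choice.

The choice is explicit. The directional derivative of `f_ω` at `xbar ω` is sublinear;
differentiating it successively in the directions of a dense sequence makes it linear in each of
them, and the limit is a continuous linear functional. Only countable limits and infima occur, so
measurability in `ω` survives. Reflexivity makes the dual separable, which upgrades weak to strong
measurability.

For claim 2, reflection through `xbar` turns the upper bound into a lower one; then `I_f` is finite,
convex and bounded above on the ball, hence continuous there. Claim 3 follows because the domain
contains this ball. -/

/-! ### Separability of the dual and strong measurability -/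

/-- The dual of a separable reflexive real normed space is separable. -/
theorem ReflexiveSpace.separableSpace_dual {X : Type*} [NormedAddCommGroup X] [NormedSpace ℝ X]
    [TopologicalSpace.SeparableSpace X] (hX : ReflexiveSpace X) :
    TopologicalSpace.SeparableSpace (StrongDual ℝ X) := by
  have hex : ∀ x : X, ∃ g : StrongDual ℝ X, ‖g‖ ≤ 1 ∧ g x = ‖x‖ :=
    fun x => by simpa using exists_dual_vector'' ℝ x
  choose g hg1 hg2 using hex
  set S : Set (StrongDual ℝ X) :=
    Set.range fun n : ℕ => g (TopologicalSpace.denseSeq X n)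
  have hSsep : TopologicalSpace.IsSeparable (Submodule.span ℝ S : Set (StrongDual ℝ X)) :=
    (Set.countable_range _).isSeparable.span
  rw [← TopologicalSpace.isSeparable_univ_iff]
  refine hSsep.closure.mono ?_
  intro φ _
  by_contra hφ
  set V := (Submodule.span ℝ S).topologicalClosure
  have hφV : φ ∉ V := hφ
  obtain ⟨F, b, hFV, hFφ⟩ := geometric_hahn_banach_closed_point V.convex
    (Submodule.isClosed_topologicalClosure _) hφV
  have hb : 0 < b := by simpa using hFV 0 V.zero_mem
  -- A functional bounded above on a subspace vanishes there: otherwise a multiple of `a` attains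
  -- the bound `b`.
  have hF2 : ∀ a ∈ V, F a = 0 := fun a ha => by
    by_contra hne
    have h := hFV ((b / F a) • a) (V.smul_mem _ ha)
    rw [map_smul, smul_eq_mul, div_mul_cancel₀ _ hne] at h
    exact h.false
  have hF1 : 0 < F φ := hb.trans hFφ
  obtain ⟨x, rfl⟩ := hX F
  have hx : ∀ n, g (TopologicalSpace.denseSeq X n) x = 0 := fun n => by
    have : g (TopologicalSpace.denseSeq X n) ∈ V :=
      Submodule.le_topologicalClosure _ (Submodule.subset_span ⟨n, rfl⟩)
    exact hF2 _ this
  have hx0 : x ≠ 0 := by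
    rintro rfl
    simp at hF1
  have hpos : 0 < ‖x‖ := norm_pos_iff.2 hx0
  obtain ⟨n, hn⟩ := (TopologicalSpace.denseRange_denseSeq X).exists_dist_lt x (half_pos hpos)
  set y := TopologicalSpace.denseSeq X n
  -- `g y` norms `y` and kills `x`, so `y` cannot be within `‖x‖ / 2` of `x`.
  have h1 : ‖y‖ ≤ ‖x - y‖ := by
    have h2 : ‖g y (y - x)‖ ≤ 1 * ‖y - x‖ := (g y).le_of_opNorm_le (hg1 y) _
    rw [map_sub, hg2, hx n, sub_zero, norm_norm, one_mul, norm_sub_rev] at h2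
    exact h2
  rw [dist_eq_norm] at hn
  have := norm_sub_norm_le x y
  linarith

/-- A weakly measurable map into a separable dual space is strongly measurable. -/
theorem stronglyMeasurable_of_forall_apply {X Ω : Type*} [NormedAddCommGroup X] [NormedSpace ℝ X]
    [TopologicalSpace.SeparableSpace X] [TopologicalSpace.SeparableSpace (StrongDual ℝ X)]
    [MeasurableSpace Ω] {q : Ω → StrongDual ℝ X} (hq : ∀ d, Measurable fun ω => q ω d) :
    StronglyMeasurable q := by
  let _ : MeasurableSpace (StrongDual ℝ X) := borel _
  have : BorelSpace (StrongDual ℝ X) := ⟨rfl⟩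
  have : SecondCountableTopology (StrongDual ℝ X) :=
    UniformSpace.secondCountable_of_separable _
  let e : StrongDual ℝ X → ℕ → ℝ := fun φ n => φ (TopologicalSpace.denseSeq X n)
  have he : Continuous e := by fun_prop
  have hinj : Function.Injective e := fun φ ψ h =>
    DFunLike.coe_injective <| φ.continuous.ext_on (TopologicalSpace.denseRange_denseSeq X)
      ψ.continuous (by rintro _ ⟨n, rfl⟩; exact congrFun h n)
  -- Lusin–Souslin: a continuous injection of a Polish space is a Borel embedding.
  have hm : MeasurableEmbedding e := he.measurableEmbedding hinj
  exact (hm.measurable_comp_iff.1 (measurable_pi_iff.2 fun n => hq _)).stronglyMeasurable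

/-! ### From sublinear functions to linear functionals -/

section Sublinear

variable {X : Type*} [NormedAddCommGroup X] [NormedSpace ℝ X]

/-- Subadditive functions that are homogeneous under doubling and bounded above by `L * ‖·‖`. -/
structure IsDyadicSublinear (p : X → ℝ) (L : ℝ) : Prop where
  add_le : ∀ x y, p (x + y) ≤ p x + p y
  two_smul : ∀ x, p ((2 : ℝ) • x) = 2 * p x
  le_norm : ∀ x, p x ≤ L * ‖x‖

/-- The directional derivative of a sublinear function `p` at the point `c`. -/
noncomputable def faceDeriv (c : X) (p : X → ℝ) (d : X) : ℝ :=
  ⨅ n : ℕ, (p (d + (2 : ℝ) ^ n • c) - 2 ^ n * p c)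

/-- Iterated directional derivatives of `p` at the points of a sequence. -/
noncomputable def iteratedFaceDeriv (c : ℕ → X) (p : X → ℝ) : ℕ → X → ℝ
  | 0 => p
  | n + 1 => faceDeriv (c n) (iteratedFaceDeriv c p n)

namespace IsDyadicSublinear

variable {p : X → ℝ} {L : ℝ} (hp : IsDyadicSublinear p L)
include hp

theorem map_zero : p 0 = 0 := by
  have := hp.two_smul 0
  rw [smul_zero] at this
  linarith

theorem pow_smul (n : ℕ) (x : X) : p ((2 : ℝ) ^ n • x) = 2 ^ n * p x := by
  induction n with
  | zero => simp
  | succ n ih => rw [pow_succ', mul_smul, hp.two_smul, ih, mul_assoc]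

theorem neg_le (x : X) : -p (-x) ≤ p x := by
  have := hp.add_le x (-x)
  rw [add_neg_cancel, hp.map_zero] at this
  linarith

theorem neg_norm_le (x : X) : -(L * ‖x‖) ≤ p x := by
  have := hp.neg_le x
  have := hp.le_norm (-x)
  rw [norm_neg] at this
  linarith

/-- Passing from `n` to `n + 1` adds a further `2 ^ n • c`, which subadditivity charges at most `2 ^
n * p c`. -/
theorem antitone_faceDeriv (c d : X) :
    Antitone fun n : ℕ => p (d + (2 : ℝ) ^ n • c) - 2 ^ n * p c := by
  refine antitone_nat_of_succ_le fun n => ?_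
  have h := hp.add_le (d + (2 : ℝ) ^ n • c) ((2 : ℝ) ^ n • c)
  rw [add_assoc, ← add_smul, ← two_mul, ← pow_succ', hp.pow_smul] at h
  have : (2 : ℝ) ^ (n + 1) * p c = 2 ^ n * p c + 2 ^ n * p c := by ring
  linarith

theorem le_faceDeriv_seq (c d : X) (n : ℕ) :
    -(L * ‖d‖) ≤ p (d + (2 : ℝ) ^ n • c) - 2 ^ n * p c := by
  have h := hp.add_le (d + (2 : ℝ) ^ n • c) (-d)
  rw [add_neg_cancel_comm, hp.pow_smul] at h
  have h2 := hp.le_norm (-d)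
  rw [norm_neg] at h2
  linarith

theorem bddBelow_faceDeriv (c d : X) :
    BddBelow (Set.range fun n : ℕ => p (d + (2 : ℝ) ^ n • c) - 2 ^ n * p c) :=
  ⟨-(L * ‖d‖), by rintro _ ⟨n, rfl⟩; exact hp.le_faceDeriv_seq c d n⟩

theorem tendsto_faceDeriv (c d : X) :
    Tendsto (fun n : ℕ => p (d + (2 : ℝ) ^ n • c) - 2 ^ n * p c) atTop (𝓝 (faceDeriv c p d)) :=
  tendsto_atTop_ciInf (hp.antitone_faceDeriv c d) (hp.bddBelow_faceDeriv c d)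

theorem faceDeriv_le_seq (c d : X) (n : ℕ) :
    faceDeriv c p d ≤ p (d + (2 : ℝ) ^ n • c) - 2 ^ n * p c :=
  ciInf_le (hp.bddBelow_faceDeriv c d) n

theorem faceDeriv_le (c d : X) : faceDeriv c p d ≤ p d := by
  have h1 := hp.faceDeriv_le_seq c d 0
  have h2 := hp.add_le d c
  simp only [pow_zero, one_smul, one_mul] at h1
  linarith

/-- The term `n = 0` is `p 0 - p c`. This inequality is what makes the derivative linear along `c`.
-/
theorem faceDeriv_neg_le (c : X) : faceDeriv c p (-c) ≤ -p c := by
  have h1 := hp.faceDeriv_le_seq c (-c) 0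
  simpa [hp.map_zero] using h1

theorem faceDeriv (c : X) : IsDyadicSublinear (faceDeriv c p) L where
  add_le x y := by
    -- The shift by one absorbs the two copies of `2 ^ n • c`, which add up to `2 ^ (n + 1) • c`.
    refine le_of_tendsto_of_tendsto' ((hp.tendsto_faceDeriv c (x + y)).comp (tendsto_add_atTop_nat 1))
      ((hp.tendsto_faceDeriv c x).add (hp.tendsto_faceDeriv c y)) fun n => ?_
    have h := hp.add_le (x + (2 : ℝ) ^ n • c) (y + (2 : ℝ) ^ n • c)
    have e : x + (2 : ℝ) ^ n • c + (y + (2 : ℝ) ^ n • c) = x + y + (2 : ℝ) ^ (n + 1) • c := by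
      rw [pow_succ', mul_smul, _root_.two_smul]; abel
    rw [e] at h
    simp only [Function.comp]
    have : (2 : ℝ) ^ (n + 1) * p c = 2 ^ n * p c + 2 ^ n * p c := by ring
    linarith
  two_smul x := by
    refine tendsto_nhds_unique
      ((hp.tendsto_faceDeriv c ((2 : ℝ) • x)).comp (tendsto_add_atTop_nat 1)) ?_
    refine ((hp.tendsto_faceDeriv c x).const_mul 2).congr fun n => ?_
    simp only [Function.comp]
    rw [pow_succ', mul_smul, ← smul_add, hp.two_smul]
    ring
  le_norm x := (hp.faceDeriv_le c x).trans (hp.le_norm x)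

theorem iteratedFaceDeriv (c : ℕ → X) (n : ℕ) :
    IsDyadicSublinear (iteratedFaceDeriv c p n) L := by
  induction n with
  | zero => exact hp
  | succ n ih => exact ih.faceDeriv (c n)

theorem antitone_iteratedFaceDeriv (c : ℕ → X) (d : X) :
    Antitone fun n => _root_.iteratedFaceDeriv c p n d :=
  antitone_nat_of_succ_le fun n => (hp.iteratedFaceDeriv c n).faceDeriv_le (c n) d

theorem bddBelow_iteratedFaceDeriv (c : ℕ → X) (d : X) :
    BddBelow (Set.range fun n => _root_.iteratedFaceDeriv c p n d) :=
  ⟨-(L * ‖d‖), by rintro _ ⟨n, rfl⟩; exact (hp.iteratedFaceDeriv c n).neg_norm_le d⟩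

theorem iInf_iteratedFaceDeriv (c : ℕ → X) :
    IsDyadicSublinear (fun d => ⨅ n, _root_.iteratedFaceDeriv c p n d) L := by
  have ht : ∀ d, Tendsto (fun n => _root_.iteratedFaceDeriv c p n d) atTop
      (𝓝 (⨅ n, _root_.iteratedFaceDeriv c p n d)) := fun d =>
    tendsto_atTop_ciInf (hp.antitone_iteratedFaceDeriv c d) (hp.bddBelow_iteratedFaceDeriv c d)
  exact
  { add_le := fun x y => le_of_tendsto_of_tendsto' (ht _) ((ht x).add (ht y)) fun n =>
      (hp.iteratedFaceDeriv c n).add_le x y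
    two_smul := fun x => tendsto_nhds_unique (ht _) <| ((ht x).const_mul 2).congr fun n =>
      ((hp.iteratedFaceDeriv c n).two_smul x).symm
    le_norm := fun x => (ciInf_le (hp.bddBelow_iteratedFaceDeriv c x) 0).trans (hp.le_norm x) }

theorem continuous : Continuous p := by
  have hl : ∀ x y, p x - p y ≤ L * ‖x - y‖ := fun x y => by
    have h := hp.add_le (x - y) y
    rw [sub_add_cancel] at h
    have := hp.le_norm (x - y)
    linarith
  refine (LipschitzWith.of_dist_le_mul (K := L.toNNReal) fun x y => ?_).continuous
  rw [Real.dist_eq, dist_eq_norm]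
  have h1 := hl x y
  have h2 := hl y x
  rw [norm_sub_rev] at h2
  have h3 : L * ‖x - y‖ ≤ L.toNNReal * ‖x - y‖ := by
    gcongr
    exact Real.le_coe_toNNReal L
  rw [abs_le]
  constructor <;> linarith

/-- The iterated directional derivatives along a dense sequence decrease to a continuous linear
functional. -/
theorem exists_strongDual {c : ℕ → X} (hc : DenseRange c) :
    ∃ q : StrongDual ℝ X, ∀ d, q d = ⨅ n, _root_.iteratedFaceDeriv c p n d := by
  set q : X → ℝ := fun d => ⨅ n, _root_.iteratedFaceDeriv c p n d with hq
  have hqs : IsDyadicSublinear q L := hp.iInf_iteratedFaceDeriv c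
  have hle : ∀ n d, q d ≤ _root_.iteratedFaceDeriv c p n d := fun n d =>
    ciInf_le (hp.bddBelow_iteratedFaceDeriv c d) n
  have hneg : ∀ d, q d + q (-d) = 0 := by
    intro d
    have hcont : Continuous fun d => q d + q (-d) :=
      hqs.continuous.add (hqs.continuous.comp continuous_neg)
    refine congrFun (hcont.ext_on hc continuous_const ?_) d
    rintro _ ⟨n, rfl⟩
    -- Stage `n` bounds `q (c n)` above and stage `n + 1` bounds `q (-c n)` by the opposite number;
    -- subadditivity gives the reverse inequality for the sum.
    have h1 := hle n (c n)
    have h2 := (hle (n + 1) (-c n)).trans ((hp.iteratedFaceDeriv c n).faceDeriv_neg_le (c n))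
    have h3 := hqs.neg_le (c n)
    show q (c n) + q (-c n) = 0
    linarith
  have hadd : ∀ x y, q (x + y) = q x + q y := fun x y => by
    have h1 := hqs.add_le x y
    have h2 := hqs.add_le (x + y) (-y)
    rw [add_neg_cancel_right] at h2
    have h3 := hneg y
    linarith
  exact ⟨(AddMonoidHom.mk' q hadd).toRealLinearMap hqs.continuous, fun d => rfl⟩

end IsDyadicSublinear

/-- The dyadic difference quotients at `0` of a convex function that is bounded above near `0`
converge to a sublinear function. -/
theorem exists_dyadicSublinear_of_convexOn {F : X → ℝ} {r M : ℝ} (hr : 0 < r)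
    (hF : ConvexOn ℝ (Metric.ball 0 r) F) (h0 : F 0 = 0)
    (hM : ∀ u ∈ Metric.ball (0 : X) r, F u ≤ M) :
    ∃ p : X → ℝ, IsDyadicSublinear p (2 * M / r) ∧
      (∀ d, Tendsto (fun n : ℕ => 2 ^ n * F ((2 : ℝ)⁻¹ ^ n • d)) atTop (𝓝 (p d))) ∧
      ∀ u ∈ Metric.ball (0 : X) r, p u ≤ F u := by
  have hmem : ∀ u : X, u ∈ Metric.ball (0 : X) r ↔ ‖u‖ < r := fun u => mem_ball_zero_iff
  have h0mem : (0 : X) ∈ Metric.ball (0 : X) r := by simpa using hr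
  have hhalf : ∀ u : X, ‖u‖ < r → F ((2 : ℝ)⁻¹ • u) ≤ 2⁻¹ * F u := fun u hu => by
    have := hF.2 ((hmem u).2 hu) h0mem (by norm_num : (0 : ℝ) ≤ 2⁻¹)
      (by norm_num : (0 : ℝ) ≤ 2⁻¹) (by norm_num)
    simpa [h0] using this
  have hmid : ∀ u v : X, ‖u‖ < r → ‖v‖ < r →
      F ((2 : ℝ)⁻¹ • (u + v)) ≤ 2⁻¹ * F u + 2⁻¹ * F v := fun u v hu hv => by
    have := hF.2 ((hmem u).2 hu) ((hmem v).2 hv) (by norm_num : (0 : ℝ) ≤ 2⁻¹)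
      (by norm_num : (0 : ℝ) ≤ 2⁻¹) (by norm_num)
    simpa [smul_add] using this
  have hlin : ∀ u : X, ‖u‖ ≤ r / 2 → F u ≤ 2 * M / r * ‖u‖ := fun u hu => by
    rcases eq_or_ne u 0 with rfl | hu0
    · simp [h0]
    have hpos : 0 < ‖u‖ := norm_pos_iff.2 hu0
    -- Chosen so that `t⁻¹ • u` has norm `r / 2`; convexity between this point and `0` gives the
    -- linear bound.
    set t := 2 * ‖u‖ / r with ht
    have ht0 : 0 < t := by positivity
    have ht1 : t ≤ 1 := by rw [ht, div_le_one hr]; linarith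
    have hw : t⁻¹ • u ∈ Metric.ball (0 : X) r := by
      rw [hmem, norm_smul, norm_inv, Real.norm_of_nonneg ht0.le, ht, inv_div, div_mul_eq_mul_div,
        div_lt_iff₀ (by positivity)]
      nlinarith
    have := hF.2 hw h0mem ht0.le (sub_nonneg.2 ht1) (by ring)
    rw [smul_inv_smul₀ ht0.ne', smul_zero, add_zero, h0, smul_zero, add_zero, smul_eq_mul] at this
    calc F u ≤ t * F (t⁻¹ • u) := this
      _ ≤ t * M := by gcongr; exact hM _ hw
      _ = 2 * M / r * ‖u‖ := by rw [ht]; ring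
  have hlow : ∀ u : X, ‖u‖ ≤ r / 2 → -(2 * M / r * ‖u‖) ≤ F u := fun u hu => by
    have h1 := hlin (-u) (by rwa [norm_neg])
    have h2 := hmid u (-u) (by linarith) (by rw [norm_neg]; linarith)
    rw [norm_neg] at h1
    rw [add_neg_cancel, smul_zero, h0] at h2
    linarith
  set s : X → ℕ → ℝ := fun d n => 2 ^ n * F ((2 : ℝ)⁻¹ ^ n • d) with hs
  have hsmall : ∀ d : X, ∀ ε > 0, ∃ N : ℕ, ∀ n ≥ N, ‖(2 : ℝ)⁻¹ ^ n • d‖ < ε := fun d ε hε => by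
    have : Tendsto (fun n : ℕ => (2 : ℝ)⁻¹ ^ n • d) atTop (𝓝 0) := by
      simpa using (tendsto_pow_atTop_nhds_zero_of_lt_one (by norm_num : (0 : ℝ) ≤ 2⁻¹)
        (by norm_num)).smul_const d
    simpa using (Metric.tendsto_atTop.1 this ε hε)
  have hpow : ∀ n : ℕ, (2 : ℝ) ^ n * 2⁻¹ ^ n = 1 := fun n => by
    rw [← mul_pow]; norm_num
  have hstep : ∀ d n, ‖(2 : ℝ)⁻¹ ^ n • d‖ < r → s d (n + 1) ≤ s d n := fun d n h => by
    have h1 := hhalf _ h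
    simp only [hs]
    rw [smul_smul, ← pow_succ'] at h1
    calc (2 : ℝ) ^ (n + 1) * F ((2 : ℝ)⁻¹ ^ (n + 1) • d)
        ≤ 2 ^ (n + 1) * (2⁻¹ * F ((2 : ℝ)⁻¹ ^ n • d)) := by gcongr
      _ = 2 ^ n * F ((2 : ℝ)⁻¹ ^ n • d) := by ring
  have hnorm : ∀ (d : X) (n : ℕ), 2 ^ n * (2 * M / r * ‖(2 : ℝ)⁻¹ ^ n • d‖) = 2 * M / r * ‖d‖ :=
    fun d n => by
      rw [norm_smul, Real.norm_of_nonneg (by positivity)]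
      linear_combination (2 * M / r * ‖d‖) * hpow n
  -- The second clause keeps the starting index free: for `d` in the ball, index `0` yields `p d ≤ F
  -- d`.
  have hlim : ∀ d, ∃ l, Tendsto (s d) atTop (𝓝 l) ∧
      (∀ N, (∀ n ≥ N, ‖(2 : ℝ)⁻¹ ^ n • d‖ < r) → l ≤ s d N) := fun d => by
    obtain ⟨N, hN⟩ := hsmall d (r / 2) (by positivity)
    have hanti : ∀ N, (∀ n ≥ N, ‖(2 : ℝ)⁻¹ ^ n • d‖ < r) → Antitone fun n => s d (n + N) :=
      fun N hN => antitone_nat_of_succ_le fun n => by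
        rw [add_right_comm]
        exact hstep d _ (hN _ (by omega))
    have hbdd : BddBelow (Set.range fun n => s d (n + N)) := by
      refine ⟨-(2 * M / r * ‖d‖), ?_⟩
      rintro _ ⟨n, rfl⟩
      have := hlow _ (hN (n + N) (by omega)).le
      have h2 : 2 ^ (n + N) * -(2 * M / r * ‖(2 : ℝ)⁻¹ ^ (n + N) • d‖) ≤ s d (n + N) := by
        simp only [hs]; gcongr
      rw [mul_neg, hnorm] at h2
      exact h2
    have ht := tendsto_atTop_ciInf (hanti N fun n hn => (hN n hn).trans (by linarith)) hbdd
    have ht' := (tendsto_add_atTop_iff_nat (f := s d) N).1 ht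
    refine ⟨_, ht', fun N' hN' => ?_⟩
    have := (hanti N' hN').le_of_tendsto ((tendsto_add_atTop_iff_nat (f := s d) N').2 ht') 0
    simpa using this
  choose p hp hple using hlim
  refine ⟨p, ⟨fun x y => ?_, fun x => ?_, fun x => ?_⟩, hp, fun u hu => ?_⟩
  · refine le_of_tendsto_of_tendsto ((hp (x + y)).comp (tendsto_add_atTop_nat 1))
      ((hp x).add (hp y)) ?_
    obtain ⟨N₁, h₁⟩ := hsmall x r hr
    obtain ⟨N₂, h₂⟩ := hsmall y r hr
    filter_upwards [eventually_ge_atTop N₁, eventually_ge_atTop N₂] with n hn₁ hn₂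
    have h := hmid _ _ (h₁ n hn₁) (h₂ n hn₂)
    rw [← smul_add, smul_smul, ← pow_succ'] at h
    simp only [Function.comp, hs]
    calc (2 : ℝ) ^ (n + 1) * F ((2 : ℝ)⁻¹ ^ (n + 1) • (x + y))
        ≤ 2 ^ (n + 1) * (2⁻¹ * F ((2 : ℝ)⁻¹ ^ n • x) + 2⁻¹ * F ((2 : ℝ)⁻¹ ^ n • y)) := by gcongr
      _ = _ := by ring
  · refine tendsto_nhds_unique ((hp ((2 : ℝ) • x)).comp (tendsto_add_atTop_nat 1)) ?_
    refine ((hp x).const_mul 2).congr fun n => ?_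
    simp only [Function.comp, hs]
    rw [smul_smul, pow_succ, pow_succ, mul_assoc ((2 : ℝ)⁻¹ ^ n), inv_mul_cancel₀ two_ne_zero,
      mul_one]
    ring
  · obtain ⟨N, hN⟩ := hsmall x (r / 2) (by positivity)
    refine le_of_tendsto (hp x) ?_
    filter_upwards [eventually_ge_atTop N] with n hn
    rw [← hnorm x n]
    simp only [hs]
    gcongr
    exact hlin _ (hN n hn).le
  · have := hple u 0 fun n _ => by
      rw [norm_smul, Real.norm_of_nonneg (by positivity)]
      have h1 : (2 : ℝ)⁻¹ ^ n ≤ 1 := pow_le_one₀ (by norm_num) (by norm_num)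
      exact (mul_le_of_le_one_left (norm_nonneg _) h1).trans_lt ((hmem u).1 hu)
    simpa [hs] using this

end Sublinear

/-! ### Measurable selection of subgradients -/

theorem measurable_iteratedFaceDeriv {X Ω : Type*} [NormedAddCommGroup X] [NormedSpace ℝ X]
    [MeasurableSpace Ω] {p : Ω → X → ℝ} (hp : ∀ d, Measurable fun ω => p ω d) (c : ℕ → X) (n : ℕ)
    (d : X) : Measurable fun ω => iteratedFaceDeriv c (p ω) n d := by
  induction n generalizing d with
  | zero => exact hp d
  | succ n ih =>
    exact Measurable.iInf fun m => (ih _).sub ((ih _).const_mul _)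

/-- A measurable family of convex functions bounded above near `0` has a measurable selection of
subgradients at `0`. -/
theorem exists_stronglyMeasurable_subgradient {X Ω : Type*} [NormedAddCommGroup X]
    [NormedSpace ℝ X] [TopologicalSpace.SeparableSpace X]
    [TopologicalSpace.SeparableSpace (StrongDual ℝ X)] [MeasurableSpace Ω]
    {F : Ω → X → ℝ} {M : Ω → ℝ} {r : ℝ} (hr : 0 < r) (hmeas : ∀ u, Measurable fun ω => F ω u)
    (hF : ∀ ω, ConvexOn ℝ (Metric.ball 0 r) (F ω)) (h0 : ∀ ω, F ω 0 = 0)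
    (hM : ∀ ω, ∀ u ∈ Metric.ball (0 : X) r, F ω u ≤ M ω) :
    ∃ q : Ω → StrongDual ℝ X, StronglyMeasurable q ∧ (∀ ω, ‖q ω‖ ≤ 2 * M ω / r) ∧
      ∀ ω, ∀ u ∈ Metric.ball (0 : X) r, q ω u ≤ F ω u := by
  choose p hp hlim hle using fun ω => exists_dyadicSublinear_of_convexOn hr (hF ω) (h0 ω) (hM ω)
  have hpm : ∀ d, Measurable fun ω => p ω d := fun d =>
    measurable_of_tendsto_metrizable (fun n => (hmeas _).const_mul _)
      (tendsto_pi_nhds.2 fun ω => hlim ω d)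
  set c := TopologicalSpace.denseSeq X
  choose q hq using fun ω =>
    (hp ω).exists_strongDual (TopologicalSpace.denseRange_denseSeq X)
  have hqp : ∀ ω d, q ω d ≤ p ω d := fun ω d => by
    rw [hq]
    exact ciInf_le ((hp ω).bddBelow_iteratedFaceDeriv c d) 0
  refine ⟨q, stronglyMeasurable_of_forall_apply fun d => ?_, fun ω => ?_, fun ω u hu =>
    (hqp ω u).trans (hle ω u hu)⟩
  · simp only [hq]
    exact Measurable.iInf fun n => measurable_iteratedFaceDeriv hpm c n d
  · have hM0 : 0 ≤ M ω := by
      rw [← h0 ω]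
      exact hM ω 0 (by simpa using hr)
    refine (q ω).opNorm_le_bound (by positivity) fun d => ?_
    have h1 := (hqp ω d).trans ((hp ω).le_norm d)
    have h2 := (hqp ω (-d)).trans ((hp ω).le_norm (-d))
    rw [norm_neg, map_neg] at h2
    rw [Real.norm_eq_abs, abs_le]
    constructor <;> linarith

/-! ### Normal convex integrands, their conjugates and the integral functional -/

namespace IsNormalConvexIntegrand

variable {X Ω : Type*} [NormedAddCommGroup X] [NormedSpace ℝ X] [MeasurableSpace X]
  [MeasurableSpace Ω] {f : X → Ω → EReal}

theorem coe_toReal (hf : IsNormalConvexIntegrand f) {x : X} {ω : Ω} (hx : f x ω ≠ ⊤) :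
    ((f x ω).toReal : EReal) = f x ω :=
  EReal.coe_toReal hx (hf.ne_bot x ω)

theorem toReal_combo_le (hf : IsNormalConvexIntegrand f) {x y : X} {ω : Ω} (hx : f x ω ≠ ⊤)
    (hy : f y ω ≠ ⊤) {a b : ℝ} (ha : 0 < a) (hb : 0 < b) (hab : a + b = 1) :
    (f (a • x + b • y) ω).toReal ≤ a * (f x ω).toReal + b * (f y ω).toReal := by
  have h := hf.convex ω x y a b ha hb hab
  rw [← hf.coe_toReal hx, ← hf.coe_toReal hy, ← EReal.coe_mul, ← EReal.coe_mul,
    ← EReal.coe_add] at h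
  exact EReal.toReal_le_toReal h (hf.ne_bot _ _) (EReal.coe_ne_top _)

theorem convexOn_toReal (hf : IsNormalConvexIntegrand f) {C : Set X} {ω : Ω} (hC : Convex ℝ C)
    (hfin : ∀ x ∈ C, f x ω ≠ ⊤) : ConvexOn ℝ C fun x => (f x ω).toReal :=
  convexOn_iff_forall_pos.2 ⟨hC, fun _ hx _ hy _ _ ha hb hab =>
    hf.toReal_combo_le (hfin _ hx) (hfin _ hy) ha hb hab⟩

/-- A local subgradient of `f_ω` at `x₀` yields the value of the conjugate. -/
theorem conjugateIntegrand_eq (hf : IsNormalConvexIntegrand f) {x₀ : X} {ω : Ω}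
    (h₀ : f x₀ ω ≠ ⊤) {r : ℝ} (hr : 0 < r) {q : StrongDual ℝ X}
    (hq : ∀ u ∈ Metric.ball (0 : X) r, q u ≤ (f (x₀ + u) ω).toReal - (f x₀ ω).toReal) :
    conjugateIntegrand f q ω = ((q x₀ - (f x₀ ω).toReal : ℝ) : EReal) := by
  refine le_antisymm (iSup_le fun x => ?_) ?_
  · by_cases hx : f x ω = ⊤
    · simp [hx]
    rw [← hf.coe_toReal hx, ← EReal.coe_sub, EReal.coe_le_coe_iff]
    -- For small `t > 0` the point `x₀ + t • (x - x₀)` lies in the ball; convexity carries the local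
    -- inequality to `x`.
    have ht : Tendsto (fun t : ℝ => t • (x - x₀)) (𝓝 0) (𝓝 0) := by
      simpa using (continuous_id.smul continuous_const).tendsto (f := fun t : ℝ => t • (x - x₀)) 0
    obtain ⟨t, ht0, htb, ht1⟩ := ((ht.eventually (Metric.ball_mem_nhds 0 hr)).and
      (eventually_lt_nhds zero_lt_one)).exists_gt
    have h1 := hq _ htb
    have h2 := hf.toReal_combo_le hx h₀ ht0 (sub_pos.2 ht1) (by ring)
    have e : t • x + (1 - t) • x₀ = x₀ + t • (x - x₀) := by module
    rw [e] at h2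
    rw [map_smul, smul_eq_mul, map_sub] at h1
    have h3 : t * (q x - q x₀) ≤ t * ((f x ω).toReal - (f x₀ ω).toReal) := by linarith
    have := le_of_mul_le_mul_left h3 ht0
    linarith
  · rw [EReal.coe_sub, hf.coe_toReal h₀]
    exact le_iSup (fun x : X => ((q x : ℝ) : EReal) - f x ω) x₀

theorem measurable_comp (hf : IsNormalConvexIntegrand f) {x : Ω → X} (hx : Measurable x) :
    Measurable fun ω => f (x ω) ω :=
  hf.measurable.comp (hx.prodMk measurable_id)

variable [BorelSpace X] {μ : Measure Ω}

theorem integrable_toReal (hf : IsNormalConvexIntegrand f) {x : Lp X (⊤ : ENNReal) μ}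
    (hx : IsIntegrablyMajorized (fun ω => f (x ω) ω) μ) :
    Integrable (fun ω => (f (x ω) ω).toReal) μ := by
  obtain ⟨g, hg, hle⟩ := hx
  refine hg.mono'
    (hf.measurable_comp (Lp.stronglyMeasurable x).measurable).ereal_toReal.aestronglyMeasurable ?_
  filter_upwards [hle] with ω hω
  have h := hf.coe_toReal (ne_top_of_le_ne_top (EReal.coe_ne_top _) hω.2)
  rw [← h, ← EReal.coe_neg, EReal.coe_le_coe_iff, EReal.coe_le_coe_iff] at hω
  exact abs_le.2 hω

end IsNormalConvexIntegrand

section IntegralFunctional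

variable {X Ω : Type*} [NormedAddCommGroup X] [MeasurableSpace Ω] {f : X → Ω → EReal}
  {μ : Measure Ω}

theorem IsIntegrablyMajorized.ae_ne_top {φ : Ω → EReal} (h : IsIntegrablyMajorized φ μ) :
    ∀ᵐ ω ∂μ, φ ω ≠ ⊤ := by
  obtain ⟨g, -, hle⟩ := h
  filter_upwards [hle] with ω hω using ne_top_of_le_ne_top (EReal.coe_ne_top _) hω.2

theorem integralFunctionalLinfty_eq {x : Lp X (⊤ : ENNReal) μ}
    (hx : IsIntegrablyMajorized (fun ω => f (x ω) ω) μ) :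
    integralFunctionalLinfty f μ x = ((∫ ω, (f (x ω) ω).toReal ∂μ : ℝ) : EReal) :=
  if_pos hx

theorem mem_effectiveDomain_integralFunctionalLinfty {x : Lp X (⊤ : ENNReal) μ} :
    x ∈ effectiveDomain (integralFunctionalLinfty f μ) ↔
      IsIntegrablyMajorized (fun ω => f (x ω) ω) μ := by
  refine ⟨fun h => ?_, fun h => ?_⟩
  · by_contra hn
    have h' : integralFunctionalLinfty f μ x ≠ ⊤ := ne_of_lt h
    exact h' (if_neg hn)
  · rw [effectiveDomain, Set.mem_ofPred_eq, integralFunctionalLinfty_eq h]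
    exact EReal.coe_lt_top _

end IntegralFunctional

/-- The support function at `v` of a set containing a ball of radius `r` about `x` is at least
`v x + r * ‖v‖`. -/
theorem le_supportFunction_of_ball_subset {E : Type*} [NormedAddCommGroup E] [NormedSpace ℝ E]
    {K : Set E} {x : E} {r : ℝ} (hr : 0 < r) (hK : Metric.ball x r ⊆ K) (v : StrongDual ℝ E) :
    ((v x + r * ‖v‖ : ℝ) : EReal) ≤ supportFunction K v := by
  have key : ∀ t < ‖v‖, ((v x + r * t : ℝ) : EReal) ≤ supportFunction K v := fun t ht => by
    obtain ⟨y, hy, hty⟩ : ∃ y : E, ‖y‖ < 1 ∧ t < v y := by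
      obtain ⟨y, hy, hty⟩ := v.exists_lt_apply_of_lt_opNorm ht
      rcases le_total 0 (v y) with h | h
      · exact ⟨y, hy, by rwa [Real.norm_of_nonneg h] at hty⟩
      · exact ⟨-y, by rwa [norm_neg], by rwa [map_neg, ← Real.norm_of_nonpos h]⟩
    have hmem : x + r • y ∈ K := hK <| by
      rw [mem_ball_iff_norm, add_sub_cancel_left, norm_smul, Real.norm_of_nonneg hr.le]
      exact mul_lt_of_lt_one_right hr hy
    refine le_trans ?_ (le_iSup₂ (f := fun (z : E) (_ : z ∈ K) => ((v z : ℝ) : EReal)) _ hmem)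
    rw [EReal.coe_le_coe_iff, map_add, map_smul, smul_eq_mul]
    gcongr
  -- The norm need not be attained, so `t` tends to `‖v‖` through values chosen to give `v x + r * t
  -- = b`.
  refine le_of_forall_lt fun a ha => ?_
  obtain ⟨b, hab, hb⟩ := EReal.lt_iff_exists_real_btwn.1 ha
  rw [EReal.coe_lt_coe_iff] at hb
  have ht : (b - v x) / r < ‖v‖ := by
    rw [div_lt_iff₀ hr]
    linarith
  have h := key _ ht
  rw [mul_div_cancel₀ _ hr.ne', add_sub_cancel] at h
  exact hab.trans_le h

/-! ### Consequences of the bound on the ball in `L^∞` -/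

section LinftyBall

variable {X Ω : Type*} [NormedAddCommGroup X] [NormedSpace ℝ X]
  [TopologicalSpace.SeparableSpace X] [MeasurableSpace X] [BorelSpace X]
  [MeasurableSpace Ω] {μ : Measure Ω} {f : X → Ω → EReal} {xbar : Lp X (⊤ : ENNReal) μ}
  {r : ℝ} {k : Ω → ℝ}

omit [TopologicalSpace.SeparableSpace X] in
/-- On the ball where `f_ω(x(ω)) ≤ k(ω)`, convexity provides an integrable lower bound as well. -/
theorem isIntegrablyMajorized_of_mem_ball (hf : IsNormalConvexIntegrand f)
    (hxbar : IsIntegrablyMajorized (fun ω => f (xbar ω) ω) μ) (hk : Integrable k μ)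
    (hbound : ∀ x : Lp X (⊤ : ENNReal) μ, ‖x - xbar‖ < r →
      ∀ᵐ ω ∂μ, f (x ω) ω ≤ (k ω : EReal))
    {x : Lp X (⊤ : ENNReal) μ} (hx : ‖x - xbar‖ < r) :
    IsIntegrablyMajorized (fun ω => f (x ω) ω) μ := by
  -- `xbar` is the midpoint of `x` and its reflection, so `f (x ω) ω ≥ 2 * f (xbar ω) ω - k ω`
  -- almost surely.
  have hx' : ‖(xbar + (xbar - x)) - xbar‖ < r := by
    rwa [add_sub_cancel_left, norm_sub_rev]
  refine ⟨fun ω => |k ω| + 2 * |(f (xbar ω) ω).toReal|,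
    hk.abs.add ((hf.integrable_toReal hxbar).abs.const_mul 2), ?_⟩
  filter_upwards [hbound x hx, hbound _ hx', Lp.coeFn_add xbar (xbar - x), Lp.coeFn_sub xbar x]
    with ω h1 h2 h3 h4
  have e : (xbar + (xbar - x) : Lp X (⊤ : ENNReal) μ) ω = xbar ω + (xbar ω - x ω) := by
    rw [h3, Pi.add_apply, h4, Pi.sub_apply]
  rw [e] at h2
  have h1t := ne_top_of_le_ne_top (EReal.coe_ne_top _) h1
  have h2t := ne_top_of_le_ne_top (EReal.coe_ne_top _) h2
  have h := hf.toReal_combo_le h1t h2t (by norm_num : (0 : ℝ) < 2⁻¹)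
    (by norm_num : (0 : ℝ) < 2⁻¹) (by norm_num)
  have e2 : (2 : ℝ)⁻¹ • x ω + (2 : ℝ)⁻¹ • (xbar ω + (xbar ω - x ω)) = xbar ω := by module
  rw [e2] at h
  rw [← hf.coe_toReal h1t, EReal.coe_le_coe_iff] at h1
  rw [← hf.coe_toReal h2t, EReal.coe_le_coe_iff] at h2
  rw [← hf.coe_toReal h1t, ← EReal.coe_neg, EReal.coe_le_coe_iff, EReal.coe_le_coe_iff]
  have h5 := neg_abs_le (f (xbar ω) ω).toReal
  have h6 := abs_nonneg (f (xbar ω) ω).toReal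
  have h7 := le_abs_self (k ω)
  constructor <;> linarith

omit [TopologicalSpace.SeparableSpace X] in
theorem continuousAt_integralFunctionalLinfty (hf : IsNormalConvexIntegrand f)
    (hxbar : IsIntegrablyMajorized (fun ω => f (xbar ω) ω) μ) (hk : Integrable k μ)
    (hbound : ∀ x : Lp X (⊤ : ENNReal) μ, ‖x - xbar‖ < r →
      ∀ᵐ ω ∂μ, f (x ω) ω ≤ (k ω : EReal))
    {x : Lp X (⊤ : ENNReal) μ} (hx : ‖x - xbar‖ < r) :
    ContinuousAt (integralFunctionalLinfty f μ) x := by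
  set H : Lp X (⊤ : ENNReal) μ → ℝ := fun x => ∫ ω, (f (x ω) ω).toReal ∂μ with hH
  have hmaj : ∀ y ∈ Metric.ball xbar r, IsIntegrablyMajorized (fun ω => f (y ω) ω) μ :=
    fun y hy => isIntegrablyMajorized_of_mem_ball hf hxbar hk hbound (mem_ball_iff_norm.1 hy)
  have hconv : ConvexOn ℝ (Metric.ball xbar r) H := by
    refine convexOn_iff_forall_pos.2 ⟨convex_ball _ _, fun y hy z hz a b ha hb hab => ?_⟩
    have hy' := hf.integrable_toReal (hmaj y hy)
    have hz' := hf.integrable_toReal (hmaj z hz)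
    have hyz := hf.integrable_toReal (hmaj _ ((convex_ball xbar r) hy hz ha.le hb.le hab))
    simp only [hH, smul_eq_mul]
    rw [← integral_const_mul, ← integral_const_mul,
      ← integral_add (hy'.const_mul a) (hz'.const_mul b)]
    refine integral_mono_ae hyz ((hy'.const_mul a).add (hz'.const_mul b)) ?_
    filter_upwards [(hmaj y hy).ae_ne_top, (hmaj z hz).ae_ne_top, Lp.coeFn_add (a • y) (b • z),
      Lp.coeFn_smul a y, Lp.coeFn_smul b z] with ω h1 h2 h3 h4 h5
    rw [h3, Pi.add_apply, h4, h5, Pi.smul_apply, Pi.smul_apply]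
    exact hf.toReal_combo_le h1 h2 ha hb hab
  have hxb : Metric.ball xbar r ∈ 𝓝 x := Metric.isOpen_ball.mem_nhds (mem_ball_iff_norm.2 hx)
  have hbd : (𝓝 x).IsBoundedUnder (· ≤ ·) H := by
    refine ⟨∫ ω, k ω ∂μ, ?_⟩
    rw [eventually_map]
    filter_upwards [hxb] with y hy
    refine integral_mono_ae (hf.integrable_toReal (hmaj y hy)) hk ?_
    filter_upwards [hbound y (mem_ball_iff_norm.1 hy)] with ω hω
    simpa using EReal.toReal_le_toReal hω (hf.ne_bot _ _) (EReal.coe_ne_top _)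
  -- A convex function on an open convex set that is bounded above near one point is continuous
  -- throughout.
  have hcont : ContinuousOn H (Metric.ball xbar r) := by
    refine ((hconv.continuousOn_tfae Metric.isOpen_ball
      ⟨x, mem_ball_iff_norm.2 hx⟩).out 3 1).mp ?_
    exact ⟨x, mem_ball_iff_norm.2 hx, hbd⟩
  have hc : ContinuousAt (fun y => (H y : EReal)) x :=
    continuous_coe_real_ereal.continuousAt.comp (hcont.continuousAt hxb)
  refine hc.congr ?_
  filter_upwards [hxb] with y hy
  exact (integralFunctionalLinfty_eq (hmaj y hy)).symm

omit [BorelSpace X] in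
/-- Testing with constant perturbations bounds `f_ω` on the ball about `xbar ω`. -/
theorem ae_forall_mem_ball_le [IsProbabilityMeasure μ] (hf : IsNormalConvexIntegrand f)
    (hbound : ∀ x : Lp X (⊤ : ENNReal) μ, ‖x - xbar‖ < r →
      ∀ᵐ ω ∂μ, f (x ω) ω ≤ (k ω : EReal)) :
    ∀ᵐ ω ∂μ, ∀ u ∈ Metric.ball (0 : X) r, f (xbar ω + u) ω ≤ (k ω : EReal) := by
  have hD : ∀ n : ℕ, ∀ᵐ ω ∂μ, ‖TopologicalSpace.denseSeq X n‖ < r →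
      f (xbar ω + TopologicalSpace.denseSeq X n) ω ≤ (k ω : EReal) := fun n => by
    by_cases hn : ‖TopologicalSpace.denseSeq X n‖ < r
    · have hle : ‖xbar + Lp.const (⊤ : ENNReal) μ (TopologicalSpace.denseSeq X n) - xbar‖ < r := by
        rw [add_sub_cancel_left]
        refine (Lp.norm_const_le _ _ _).trans_lt ?_
        simpa using hn
      filter_upwards [hbound _ hle, Lp.coeFn_add xbar (Lp.const (⊤ : ENNReal) μ
        (TopologicalSpace.denseSeq X n)), Lp.coeFn_const (⊤ : ENNReal) μ
        (TopologicalSpace.denseSeq X n)] with ω h1 h2 h3 _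
      rwa [h2, Pi.add_apply, h3] at h1
    · exact Eventually.of_forall fun ω h => absurd h hn
  filter_upwards [ae_all_iff.2 hD] with ω hω u hu
  have hcl : IsClosed {v : X | f (xbar ω + v) ω ≤ (k ω : EReal)} :=
    ((hf.lowerSemicontinuous ω).isClosed_preimage (k ω : EReal)).preimage
      (continuous_const.add continuous_id)
  refine closure_minimal ?_ hcl
    ((TopologicalSpace.denseRange_denseSeq X).open_subset_closure_inter Metric.isOpen_ball hu)
  rintro _ ⟨hv, n, rfl⟩
  exact hω n (mem_ball_zero_iff.1 hv)

theorem exists_integrable_conjugate [IsProbabilityMeasure μ]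
    [TopologicalSpace.SeparableSpace (StrongDual ℝ X)] (hf : IsNormalConvexIntegrand f)
    (hxbar : IsIntegrablyMajorized (fun ω => f (xbar ω) ω) μ) (hr : 0 < r) (hk : Integrable k μ)
    (hbound : ∀ x : Lp X (⊤ : ENNReal) μ, ‖x - xbar‖ < r →
      ∀ᵐ ω ∂μ, f (x ω) ω ≤ (k ω : EReal)) :
    ∃ xstar : Lp (StrongDual ℝ X) 1 μ,
      IsIntegrablyMajorized (fun ω => conjugateIntegrand f (xstar ω) ω) μ := by
  classical
  obtain ⟨B, hB, hBm, hB0⟩ := exists_measurable_superset_of_null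
    (ae_iff.1 (ae_forall_mem_ball_le hf hbound))
  have hgood : ∀ ω ∉ B, ∀ u ∈ Metric.ball (0 : X) r, f (xbar ω + u) ω ≤ (k ω : EReal) :=
    fun ω hω => by_contra fun h => hω (hB h)
  have h0mem : (0 : X) ∈ Metric.ball (0 : X) r := by simpa using hr
  have hxm : Measurable (xbar : Ω → X) := (Lp.stronglyMeasurable xbar).measurable
  have hfin : ∀ ω ∉ B, ∀ u ∈ Metric.ball (0 : X) r, f (xbar ω + u) ω ≠ ⊤ := fun ω hω u hu =>
    ne_top_of_le_ne_top (EReal.coe_ne_top _) (hgood ω hω u hu)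
  set φ : Ω → ℝ := fun ω => (f (xbar ω) ω).toReal with hφ
  have hφi : Integrable φ μ := hf.integrable_toReal hxbar
  -- Zeroing the data on the measurable null set `B` makes the hypotheses hold for every `ω`, not
  -- just almost every one.
  obtain ⟨q, hqm, hqn, hq⟩ := exists_stronglyMeasurable_subgradient (X := X)
    (F := fun ω u => if ω ∈ B then 0 else (f (xbar ω + u) ω).toReal - φ ω)
    (M := fun ω => if ω ∈ B then 0 else k ω - φ ω) hr
    (fun u => Measurable.ite hBm measurable_const
      ((hf.measurable_comp (hxm.add_const u)).ereal_toReal.sub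
        (hf.measurable_comp hxm).ereal_toReal))
    (fun ω => by
      by_cases hω : ω ∈ B
      · simpa only [hω, if_true] using convexOn_const 0 (convex_ball (0 : X) r)
      · simp only [hω, if_false]
        have h := hf.convexOn_toReal (ω := ω) (convex_ball (xbar ω) r) fun x hx => by
          have := hfin ω hω (x - xbar ω) (by simpa [dist_eq_norm] using hx)
          rwa [add_sub_cancel] at this
        have h2 := h.translate_right (xbar ω)
        have e : (fun z => xbar ω + z) ⁻¹' Metric.ball (xbar ω) r = Metric.ball 0 r := by
          ext; simp
        rw [e] at h2
        exact h2.sub (concaveOn_const (φ ω) (convex_ball (0 : X) r)))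
    (fun ω => by simp [hφ])
    (fun ω u hu => by
      by_cases hω : ω ∈ B
      · simp [hω]
      · simp only [hω, if_false]
        have := EReal.toReal_le_toReal (hgood ω hω u hu) (hf.ne_bot _ _) (EReal.coe_ne_top _)
        rw [EReal.toReal_coe] at this
        linarith)
  have hBae : ∀ᵐ ω ∂μ, ω ∉ B := measure_eq_zero_iff_ae_notMem.1 hB0
  have hbi : Integrable (fun ω => 2 * (k ω - φ ω) / r) μ :=
    ((hk.sub hφi).const_mul 2).div_const r
  have hqb : ∀ᵐ ω ∂μ, ‖q ω‖ ≤ 2 * (k ω - φ ω) / r := by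
    filter_upwards [hBae] with ω hω
    simpa [hω] using hqn ω
  have hqi : Integrable q μ := hbi.mono' hqm.aestronglyMeasurable hqb
  refine ⟨hqi.toL1 q, fun ω => 2 * (k ω - φ ω) / r * ‖xbar‖ + |φ ω|,
    (hbi.mul_const _).add hφi.abs, ?_⟩
  have hxn : ∀ᵐ ω ∂μ, ‖xbar ω‖ ≤ ‖xbar‖ := by
    filter_upwards [ae_le_eLpNormEssSup (f := xbar) (μ := μ)] with ω hω
    rw [← eLpNorm_exponent_top, ← Lp.enorm_def] at hω
    exact enorm_le_iff_norm_le.1 hω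
  filter_upwards [hqi.coeFn_toL1, hBae, hqb, hxn] with ω h1 h2 h3 h4
  have hf0 : f (xbar ω) ω ≠ ⊤ := by simpa using hfin ω h2 0 h0mem
  -- The conjugate equals `q ω (xbar ω) - φ ω`, which the bound on `‖q ω‖` and the boundedness of
  -- `xbar` majorize.
  have hc := hf.conjugateIntegrand_eq hf0 hr (q := q ω) fun u hu => by
    simpa [h2] using hq ω u hu
  rw [h1, hc, ← EReal.coe_neg, EReal.coe_le_coe_iff, EReal.coe_le_coe_iff, ← abs_le]
  refine (abs_sub _ _).trans (add_le_add ?_ le_rfl)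
  calc |q ω (xbar ω)| ≤ ‖q ω‖ * ‖xbar ω‖ := (q ω).le_opNorm _
    _ ≤ 2 * (k ω - φ ω) / r * ‖xbar‖ :=
      mul_le_mul h3 h4 (norm_nonneg _) ((norm_nonneg _).trans h3)

end LinftyBall

theorem mainTheorem5
    {X : Type*} [NormedAddCommGroup X] [NormedSpace ℝ X] [CompleteSpace X]
    [TopologicalSpace.SeparableSpace X] [MeasurableSpace X] [BorelSpace X]
    (hX : ReflexiveSpace X)
    {Ω : Type*} [MeasurableSpace Ω] (μ : Measure Ω) [IsProbabilityMeasure μ] [μ.IsComplete]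
    (f : X → Ω → EReal) (hf : IsNormalConvexIntegrand f)
    (xbar : Lp X (⊤ : ENNReal) μ)
    (hxbar : xbar ∈ effectiveDomain (integralFunctionalLinfty f μ))
    (r : ℝ) (hr : 0 < r) (k : Ω → ℝ) (hk : Integrable k μ)
    (hbound : ∀ x : Lp X (⊤ : ENNReal) μ, ‖x - xbar‖ < r →
      ∀ᵐ ω ∂μ, f (x ω) ω ≤ (k ω : EReal)) :
    (∃ xstar : Lp (StrongDual ℝ X) 1 μ,
      IsIntegrablyMajorized (fun ω => conjugateIntegrand f (xstar ω) ω) μ) ∧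
    (∀ x : Lp X (⊤ : ENNReal) μ, ‖x - xbar‖ < r →
      x ∈ effectiveDomain (integralFunctionalLinfty f μ) ∧
      ContinuousAt (integralFunctionalLinfty f μ) x) ∧
    (∀ v : StrongDual ℝ (Lp X (⊤ : ENNReal) μ), IsSingularFunctional v →
      ((v xbar + r * ‖v‖ : ℝ) : EReal) ≤
        supportFunction (effectiveDomain (integralFunctionalLinfty f μ)) v) := by
  have hmaj := mem_effectiveDomain_integralFunctionalLinfty.1 hxbar
  have hball : ∀ x : Lp X (⊤ : ENNReal) μ, ‖x - xbar‖ < r →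
      x ∈ effectiveDomain (integralFunctionalLinfty f μ) := fun x hx =>
    mem_effectiveDomain_integralFunctionalLinfty.2
      (isIntegrablyMajorized_of_mem_ball hf hmaj hk hbound hx)
  have := hX.separableSpace_dual
  exact ⟨exists_integrable_conjugate hf hmaj hr hk hbound,
    fun x hx => ⟨hball x hx, continuousAt_integralFunctionalLinfty hf hmaj hk hbound hx⟩,
    fun v _ => le_supportFunction_of_ball_subset hr
      (fun x hx => hball x (mem_ball_iff_norm.1 hx)) v⟩
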